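/- All graphs are finite and simple. For a graph $G$ with adjacency matrix $A$, there is \emph{perfect state transfer} between vertices $u$ and $v$ if $|\exp(\mathrm{i}tA)_{v,u}| = 1$ for some real $t \ge 0$. Theorem. Let $Y_1$ and $Y_2$ be disjoint connected graphs, let $a$ be a vertex of $Y_1$ and $b$ a vertex of $Y_2$, and let $Z$ be the graph obtained from $Y_1$ and $Y_2$ by adding one new vertex $c$ and the two edges $ac$ and $cb$ (so $a$ and $b$ are joined by the path $P_3$ with two edges, to whose ends $Y_1$ and $Y_2$ are attached). If there is perfect state transfer between $a$ and $b$ in $Z$, then $Y_1$ and $Y_2$ have exactly one vertex each, and hence $Z$ is isomorphic to the path $P_3$ on three vertices. -/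

import Mathlib

open Classical in
/-- The transition matrix `U(t) = exp(i t A)` of the continuous-time quantum walk on a finite
graph `G` with adjacency matrix `A`. -/
noncomputable def transitionMatrix {V : Type*} [Fintype V] (G : SimpleGraph V) (t : ℝ) :
    Matrix V V ℂ :=
  NormedSpace.exp ((Complex.I * (t : ℂ)) • G.adjMatrix ℂ)

/-- Perfect state transfer between the vertices `a` and `b`: at some time `t ≥ 0`, the entry
`⟨b| U(t) |a⟩` has absolute value `1`. -/
def HasPerfectStateTransfer {V : Type*} [Fintype V] (G : SimpleGraph V) (a b : V) : Prop :=
  ∃ t : ℝ, 0 ≤ t ∧ ‖transitionMatrix G t b a‖ = 1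

/-- Adjacency in the graph built from disjoint copies of `Y₁` and `Y₂` and one new vertex `c`,
by joining `c` to the vertex `a` of `Y₁` and to the vertex `b` of `Y₂`. The vertices of `Y₁` are
the `Sum.inl u`, the vertex `c` is `Sum.inr (Sum.inl ())`, and the vertices of `Y₂` are the
`Sum.inr (Sum.inr w)`. -/
def twoBridgeAdj {V₁ V₂ : Type*} (Y₁ : SimpleGraph V₁) (a : V₁) (Y₂ : SimpleGraph V₂) (b : V₂) :
    V₁ ⊕ Unit ⊕ V₂ → V₁ ⊕ Unit ⊕ V₂ → Prop
  | Sum.inl u, Sum.inl v => Y₁.Adj u v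
  | Sum.inl u, Sum.inr (Sum.inl _) => u = a
  | Sum.inl _, Sum.inr (Sum.inr _) => False
  | Sum.inr (Sum.inl _), Sum.inl u => u = a
  | Sum.inr (Sum.inl _), Sum.inr (Sum.inl _) => False
  | Sum.inr (Sum.inl _), Sum.inr (Sum.inr w) => w = b
  | Sum.inr (Sum.inr _), Sum.inl _ => False
  | Sum.inr (Sum.inr w), Sum.inr (Sum.inl _) => w = b
  | Sum.inr (Sum.inr w), Sum.inr (Sum.inr x) => Y₂.Adj w x

/-- The graph `Z` obtained from the path `a - c - b` (that is, `X = P₃`) by attaching `Y₁` at `a`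
and `Y₂` at `b`. -/
def twoBridgeGraph {V₁ V₂ : Type*} (Y₁ : SimpleGraph V₁) (a : V₁) (Y₂ : SimpleGraph V₂) (b : V₂) :
    SimpleGraph (V₁ ⊕ Unit ⊕ V₂) where
  Adj := twoBridgeAdj Y₁ a Y₂ b
  symm := ⟨by
    rintro (u | u | u) (v | v | v) h <;>
      first
        | exact h
        | exact SimpleGraph.Adj.symm (h : Y₁.Adj _ _)
        | exact SimpleGraph.Adj.symm (h : Y₂.Adj _ _)⟩
  loopless := ⟨by
    rintro (u | u | u) h
    · exact Y₁.irrefl h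
    · exact h
    · exact Y₂.irrefl h⟩

/-! Let A be the adjacency matrix of Z, A₁ that of Y₁ and U = exp(itA). Transfer at time t gives U
e_a = γ e_b and U e_b = γ e_a, so a and b are cospectral and walks from e_a - e_b cancel at c. Hence
exp(itA₁) e_a = -γ e_a. An eigenvalue λ of Y₁ with an eigenvector nonzero at a has e^{itλ} = -γ; an
eigenvalue μ of Z with an eigenvector equal and nonzero at a and b has e^{itμ} = γ. So every μ - λ
is an odd multiple of π/t. These differences are algebraic integers permuted by Galois, hence odd
multiples of some d ≥ 1 (`exists_one_le_forall_odd_mul`).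

Suppose deg a > 0. Eliminating the coordinates in Y₁ gives μ = 2 Σ w_j/(μ - λ_j), with w the
spectral measure of Y₁ at a. As |μ - λ_j| ≥ d, this forces |μ| < 2/d. The μ differ by multiples of
2d, so at most two occur. Yet their natural weights have mean 0 and variance deg a + 2 ≥ 3, which is
too large (`variance_lt_three_of_progression`). So deg a = 0, cospectrality gives deg b = 0, and
connectedness finishes. -/

/-! ### Integrality and Galois conjugation of eigenvalues -/

open Matrix in
/-- A vector of eigenvalue `z` of the adjacency matrix that takes the value `1` at `a` and `b`. -/
def HasUnitEigenvector {V : Type*} [Fintype V] (G : SimpleGraph V) [DecidableRel G.Adj]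
    (a b : V) (z : ℂ) : Prop :=
  ∃ x : V → ℂ, G.adjMatrix ℂ *ᵥ x = z • x ∧ x a = 1 ∧ x b = 1

namespace HasUnitEigenvector

variable {V : Type*} [Fintype V] {G : SimpleGraph V} [DecidableRel G.Adj] {a b : V}

/-- The ℤ-span of the coordinates of x is finitely generated, stable under z, and nonzero since x a
= 1. -/
theorem isIntegral {z : ℂ} (h : HasUnitEigenvector G a b z) : IsIntegral ℤ z := by
  obtain ⟨x, hx, ha, -⟩ := h
  refine isIntegral_of_smul_mem_submodule (M := ℂ) (Submodule.span ℤ (Set.range x)) ?_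
    (Submodule.fg_span (Set.finite_range x)) z ?_
  · intro h0
    have : x a ∈ Submodule.span ℤ (Set.range x) := Submodule.subset_span ⟨a, rfl⟩
    rw [h0, Submodule.mem_bot, ha] at this
    exact one_ne_zero this
  · intro n hn
    induction hn using Submodule.span_induction with
    | mem y hy =>
      obtain ⟨i, rfl⟩ := hy
      have := congrFun hx i
      rw [SimpleGraph.adjMatrix_mulVec_apply, Pi.smul_apply] at this
      rw [← this]
      exact Submodule.sum_mem _ fun j _ => Submodule.subset_span ⟨j, rfl⟩
    | zero => simp
    | add y w _ _ hy hw => rw [smul_add]; exact add_mem hy hw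
    | smul k y _ hy => rw [smul_comm]; exact Submodule.smul_mem _ _ hy

/-- A K-linear retraction f of ℂ onto K moves the eigenvector into K, where s acts coordinatewise.
The matrix is rational, and the values 1 survive both maps. -/
theorem galois {K : IntermediateField ℚ ℂ} (s : K ≃ₐ[ℚ] K) {z : K}
    (h : HasUnitEigenvector G a b (z : ℂ)) : HasUnitEigenvector G a b (s z : ℂ) := by
  obtain ⟨x, hx, ha, hb⟩ := h
  obtain ⟨f, hf⟩ := LinearMap.exists_leftInverse_of_injective (Algebra.linearMap K ℂ)
    (LinearMap.ker_eq_bot.2 (FaithfulSMul.algebraMap_injective K ℂ))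
  have hf1 : f 1 = 1 := by simpa using LinearMap.congr_fun hf 1
  refine ⟨fun i => (s (f (x i)) : ℂ), ?_, by simp [ha, hf1], by simp [hb, hf1]⟩
  ext i
  have := congrFun hx i
  rw [SimpleGraph.adjMatrix_mulVec_apply, Pi.smul_apply] at this
  rw [SimpleGraph.adjMatrix_mulVec_apply, Pi.smul_apply]
  have h2 := congrArg (fun w => (s (f w) : ℂ)) this
  have h3 : f ((z : ℂ) * x i) = z * f (x i) := f.map_smul z (x i)
  simpa [h3] using h2

end HasUnitEigenvector

/-! ### The arithmetic of the differences -/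

/-- A Galois stable set of algebraic integers, all of them odd multiples of a nonzero real number,
consists of odd multiples of a real number that is at least one. -/
theorem exists_one_le_forall_odd_mul {D : Set ℂ} (hne : D.Nonempty) {e : ℝ} (he : e ≠ 0)
    (hodd : ∀ x ∈ D, ∃ n : ℤ, Odd n ∧ x = n * (e : ℂ)) (hint : ∀ x ∈ D, IsIntegral ℤ x)
    (hgal : ∀ (s : algebraicClosure ℚ ℂ ≃ₐ[ℚ] algebraicClosure ℚ ℂ) (x : algebraicClosure ℚ ℂ),
      (x : ℂ) ∈ D → (s x : ℂ) ∈ D) :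
    ∃ d : ℝ, 1 ≤ d ∧ ∀ x ∈ D, ∃ n : ℤ, Odd n ∧ x = n * (d : ℂ) := by
  set K := algebraicClosure ℚ ℂ with hK
  let H : AddSubgroup ℂ := AddSubgroup.closure D
  -- m generates the group of integers k with k e in H, so d = m e generates H.
  obtain ⟨m, hm⟩ := Int.subgroup_cyclic (H.comap (zmultiplesHom ℂ (e : ℂ)))
  rw [← AddSubgroup.zmultiples_eq_closure] at hm
  have hHe : ∀ x ∈ H, ∃ k : ℤ, x = k * (e : ℂ) := by
    intro x hx
    induction hx using AddSubgroup.closure_induction with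
    | mem x hx => obtain ⟨n, -, h⟩ := hodd x hx; exact ⟨n, h⟩
    | zero => exact ⟨0, by simp⟩
    | add x y _ _ hx hy =>
      obtain ⟨k, rfl⟩ := hx; obtain ⟨l, rfl⟩ := hy
      exact ⟨k + l, by push_cast; ring⟩
    | neg x _ hx => obtain ⟨k, rfl⟩ := hx; exact ⟨-k, by push_cast; ring⟩
  have hmem : ∀ k : ℤ, (k * (e : ℂ)) ∈ H ↔ m ∣ k := by
    intro k
    have : k ∈ H.comap (zmultiplesHom ℂ (e : ℂ)) ↔ m ∣ k := by
      rw [hm, Int.mem_zmultiples_iff]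
    simpa using this
  have hHd : ∀ x ∈ H, ∃ k : ℤ, x = k * ((m * e : ℝ) : ℂ) := by
    intro x hx
    obtain ⟨k, rfl⟩ := hHe x hx
    obtain ⟨l, rfl⟩ := (hmem k).1 hx
    exact ⟨l, by push_cast; ring⟩
  set d : ℝ := m * e with hd
  have hdH : (d : ℂ) ∈ H := by simpa [hd] using (hmem m).2 dvd_rfl
  have hDd : ∀ x ∈ D, ∃ n : ℤ, Odd n ∧ x = n * (d : ℂ) := by
    intro x hx
    obtain ⟨k, hk, rfl⟩ := hodd x hx
    obtain ⟨l, rfl⟩ := (hmem k).1 (AddSubgroup.subset_closure hx)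
    -- A factor of an odd integer is odd, so passing from e to d preserves oddness.
    exact ⟨l, (Int.odd_mul.1 hk).2, by rw [hd]; push_cast; ring⟩
  have hd0 : d ≠ 0 := by
    obtain ⟨x, hx⟩ := hne
    obtain ⟨k, hk, h⟩ := hDd x hx
    obtain ⟨n, hn, h'⟩ := hodd x hx
    rintro h0
    rw [h0, h'] at h
    have hn0 : n ≠ 0 := by rintro rfl; simp at hn
    simp [he, hn0] at h
  have hHint : ∀ x ∈ H, IsIntegral ℤ x := by
    intro x hx
    induction hx using AddSubgroup.closure_induction with
    | mem x hx => exact hint x hx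
    | zero => exact isIntegral_zero
    | add x y _ _ hx hy => exact hx.add hy
    | neg x _ hx => exact hx.neg
  have hHgal : ∀ x ∈ H, ∀ (s : K ≃ₐ[ℚ] K) (z : K), (z : ℂ) = x → (s z : ℂ) ∈ H := by
    intro x hx s
    induction hx using AddSubgroup.closure_induction with
    | mem x hx =>
      rintro z rfl
      exact AddSubgroup.subset_closure (hgal s z hx)
    | zero =>
      intro z hz
      have : z = 0 := by exact_mod_cast hz
      simp [this, H.zero_mem]
    | add x y hx hy ihx ihy =>
      intro z hz
      have hxK : x ∈ K := mem_algebraicClosure_iff.2 ((hHint x hx).tower_top.isAlgebraic)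
      have hyK : y ∈ K := mem_algebraicClosure_iff.2 ((hHint y hy).tower_top.isAlgebraic)
      have : z = ⟨x, hxK⟩ + ⟨y, hyK⟩ := Subtype.ext hz
      rw [this, map_add]
      exact H.add_mem (ihx _ rfl) (ihy _ rfl)
    | neg x hx ihx =>
      intro z hz
      have := ihx (-z) (by simp [hz])
      simpa using H.neg_mem this
  have hdK : (d : ℂ) ∈ K := mem_algebraicClosure_iff.2 ((hHint _ hdH).tower_top.isAlgebraic)
  let δ : K := ⟨d, hdK⟩
  have hdC : (d : ℂ) ≠ 0 := by exact_mod_cast hd0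
  have hδ0 : δ ≠ 0 := fun h => hdC (congrArg Subtype.val h)
  have hsd : ∀ s : K ≃ₐ[ℚ] K, ∃ k : ℤ, s δ = k * δ := by
    intro s
    obtain ⟨k, hk⟩ := hHd _ (hHgal _ hdH s δ rfl)
    exact ⟨k, Subtype.ext (by simpa using hk)⟩
  -- s and its inverse scale δ by integers with product 1, so s δ = ±δ. Thus d² is rational and
  -- integral, a positive integer.
  have hfix : ∀ s : K ≃ₐ[ℚ] K, s (δ ^ 2) = δ ^ 2 := by
    intro s
    obtain ⟨k, hk⟩ := hsd s
    obtain ⟨l, hl⟩ := hsd s.symm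
    have h1 : (l : K) * k * δ = 1 * δ := by
      have := congrArg s.symm hk
      rw [AlgEquiv.symm_apply_apply, map_mul, hl, map_intCast] at this
      rw [one_mul]
      nth_rw 2 [this]
      ring
    have h2 : l * k = 1 := by exact_mod_cast mul_right_cancel₀ hδ0 h1
    have h3 : k * k = 1 := by
      rcases Int.eq_one_or_neg_one_of_mul_eq_one (mul_comm l k ▸ h2) with h | h <;> simp [h]
    have h4 : (k : K) * k = 1 := by exact_mod_cast h3
    rw [map_pow, hk]
    linear_combination δ ^ 2 * h4
  have : IsAlgClosure ℚ K := algebraicClosure.isAlgClosure ℚ ℂ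
  have : Normal ℚ K := IsAlgClosure.normal ℚ K
  have : IsGalois ℚ K := ⟨⟩
  obtain ⟨q, hq⟩ := IntermediateField.mem_bot.1 ((InfiniteGalois.mem_bot_iff_fixed (δ ^ 2)).2 hfix)
  have hq' : (q : ℂ) = (d : ℂ) ^ 2 := by
    have := congrArg (Subtype.val : K → ℂ) hq
    simpa using this
  have hqint : IsIntegral ℤ q := by
    have : IsIntegral ℤ (algebraMap ℚ ℂ q) := by
      simpa [hq'] using (hHint _ hdH).pow 2
    exact (isIntegral_algebraMap_iff (FaithfulSMul.algebraMap_injective ℚ ℂ)).1 this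
  obtain ⟨N, rfl⟩ := IsIntegrallyClosed.isIntegral_iff.1 hqint
  have hN : (N : ℝ) = d ^ 2 := by
    have : ((N : ℝ) : ℂ) = ((d ^ 2 : ℝ) : ℂ) := by simpa using hq'
    exact_mod_cast this
  have hN1 : 1 ≤ N := by
    have : (0 : ℝ) < N := by rw [hN]; positivity
    exact_mod_cast this
  have hd1 : 1 ≤ |d| := by
    have : (1 : ℝ) ≤ N := by exact_mod_cast hN1
    rw [hN] at this
    exact (one_le_sq_iff_one_le_abs d).1 this
  refine ⟨|d|, hd1, fun x hx => ?_⟩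
  obtain ⟨n, hn, h⟩ := hDd x hx
  rcases abs_choice d with h' | h' <;> rw [h']
  · exact ⟨n, hn, h⟩
  · exact ⟨-n, hn.neg, by rw [h]; push_cast; ring⟩

/-! ### Matrix exponentials and state transfer -/

open Matrix in
/-- The coordinates of `exp X *ᵥ v` as sums of series. -/
theorem hasSum_exp_mulVec_apply {V : Type*} [Fintype V] [DecidableEq V] (X : Matrix V V ℂ)
    (v : V → ℂ) (i : V) :
    HasSum (fun n : ℕ => ((n.factorial : ℂ)⁻¹) * (X ^ n *ᵥ v) i) ((NormedSpace.exp X *ᵥ v) i) := by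
  let _ := Matrix.linftyOpNormedRing (n := V) (α := ℂ)
  let _ := Matrix.linftyOpNormedAlgebra (n := V) (R := ℂ) (α := ℂ)
  have h := NormedSpace.exp_series_hasSum_exp' (𝕂 := ℂ) X
  let f : Matrix V V ℂ →ₗ[ℂ] ℂ :=
    { toFun := fun M => (M *ᵥ v) i
      map_add' := fun M N => by simp [Matrix.add_mulVec]
      map_smul' := fun c M => by simp [Matrix.smul_mulVec] }
  have h2 := h.mapL (LinearMap.toContinuousLinearMap f)
  have h3 : ∀ M : Matrix V V ℂ, LinearMap.toContinuousLinearMap f M = (M *ᵥ v) i := fun _ => rfl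
  simp only [h3, Matrix.smul_mulVec, Pi.smul_apply, smul_eq_mul] at h2
  exact h2

open Matrix in
theorem pow_mulVec_of_mulVec_eq_smul {V : Type*} [Fintype V] [DecidableEq V] {X : Matrix V V ℂ}
    {x : V → ℂ} {z : ℂ} (h : X *ᵥ x = z • x) (n : ℕ) : X ^ n *ᵥ x = z ^ n • x := by
  induction n with
  | zero => simp
  | succ n ih => rw [pow_succ, ← Matrix.mulVec_mulVec, h, Matrix.mulVec_smul, ih, smul_smul,
      pow_succ']

open Matrix in
theorem exp_mulVec_of_mulVec_eq_smul {V : Type*} [Fintype V] [DecidableEq V] {X : Matrix V V ℂ}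
    {x : V → ℂ} {z : ℂ} (h : X *ᵥ x = z • x) : NormedSpace.exp X *ᵥ x = Complex.exp z • x := by
  ext i
  refine (hasSum_exp_mulVec_apply X x i).unique ?_
  have := (NormedSpace.exp_series_hasSum_exp' (𝕂 := ℂ) z).mul_right (x i)
  simpa [pow_mulVec_of_mulVec_eq_smul h, Complex.exp_eq_exp_ℂ, mul_assoc] using this

open Matrix in
/-- Perfect state transfer swaps the two coordinate vectors, up to a common phase. -/
theorem HasPerfectStateTransfer.exists_mulVec_single {V : Type*} [Fintype V] [DecidableEq V]
    {G : SimpleGraph V} [DecidableRel G.Adj] {a b : V} (hab : a ≠ b)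
    (h : HasPerfectStateTransfer G a b) :
    ∃ (t : ℝ) (γ : ℂ), 0 < t ∧ γ ≠ 0 ∧
      NormedSpace.exp ((Complex.I * (t : ℂ)) • G.adjMatrix ℂ) *ᵥ Pi.single a 1
        = γ • Pi.single b 1 ∧
      NormedSpace.exp ((Complex.I * (t : ℂ)) • G.adjMatrix ℂ) *ᵥ Pi.single b 1
        = γ • Pi.single a 1 := by
  obtain ⟨t, ht, h⟩ := h
  set U := NormedSpace.exp ((Complex.I * (t : ℂ)) • G.adjMatrix ℂ) with hU
  have hUt : transitionMatrix G t = U := by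
    unfold transitionMatrix
    rw [hU]
    -- Only the decidability instances differ.
    congr!
  rw [hUt] at h
  have hsymm : ∀ i j, U i j = U j i := by
    have : ((Complex.I * (t : ℂ)) • G.adjMatrix ℂ).IsSymm := by
      rw [Matrix.IsSymm, Matrix.transpose_smul, SimpleGraph.transpose_adjMatrix]
    exact fun i j => this.exp.apply j i
  have hunit : Uᴴ * U = 1 := by
    have h1 : Uᴴ = NormedSpace.exp (-((Complex.I * (t : ℂ)) • G.adjMatrix ℂ)) := by
      rw [hU, ← Matrix.exp_conjTranspose, Matrix.conjTranspose_smul]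
      congr 1
      ext i j
      simp [SimpleGraph.adjMatrix_apply, SimpleGraph.adj_comm]
      try split_ifs <;> simp
    rw [h1, hU, ← Matrix.exp_add_of_commute _ _ (Commute.refl (_ : Matrix V V ℂ)).neg_left]
    simp
  -- Columns of a unitary matrix have norm one, so an entry of modulus one is alone in its column.
  have hcol : ∀ a b, ‖U b a‖ = 1 → ∀ j, j ≠ b → U j a = 0 := by
    intro a b h j hj
    have h1 := congrFun (congrFun hunit a) a
    have h2 : ∑ j, ‖U j a‖ ^ 2 = 1 := by
      rw [Matrix.mul_apply, Matrix.one_apply_eq] at h1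
      have : ((∑ j, ‖U j a‖ ^ 2 : ℝ) : ℂ) = 1 := by
        rw [← h1]
        push_cast
        refine Finset.sum_congr rfl fun j _ => ?_
        rw [Matrix.conjTranspose_apply]
        exact (Complex.conj_mul' _).symm
      exact_mod_cast this
    rw [← Finset.add_sum_erase _ _ (Finset.mem_univ b), h] at h2
    have h3 : ∑ j ∈ Finset.univ.erase b, ‖U j a‖ ^ 2 = 0 := by linarith
    have h4 := (Finset.sum_eq_zero_iff_of_nonneg fun j _ => by positivity).1 h3 j (by simp [hj])
    simpa using h4
  refine ⟨t, U b a, ht.lt_of_ne ?_, ?_, ?_, ?_⟩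
  · rintro rfl
    have : U = 1 := by simp [hU]
    rw [this, Matrix.one_apply_ne hab.symm] at h
    simp at h
  · intro h0
    simp [h0] at h
  · rw [← hU]
    ext j
    by_cases hj : j = b
    · subst hj; simp
    · simp [hj, hcol a b h j hj]
  · rw [← hU]
    ext j
    by_cases hj : j = a
    · subst hj; simp [hsymm]
    · simp [hj, hcol b a (by rw [hsymm, h]) j hj]

open Matrix in
theorem exp_smul_mulVec_dotProduct {V : Type*} [Fintype V] [DecidableEq V] {X : Matrix V V ℂ}
    (hX : X.IsSymm) (c : ℂ) (v w : V → ℂ) :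
    (NormedSpace.exp (c • X) *ᵥ v) ⬝ᵥ w = v ⬝ᵥ (NormedSpace.exp (c • X) *ᵥ w) := by
  have h : (NormedSpace.exp (c • X)).IsSymm := (hX.smul c).exp
  rw [Matrix.dotProduct_mulVec, ← Matrix.mulVec_transpose, h.eq]

-- Move U, which commutes with X^n, across the pairing of e_b with X^n e_a. The pairing is bilinear,
-- so both sides carry the same factor γ.
open Matrix in
theorem pow_apply_eq_of_exp_mulVec_single {V : Type*} [Fintype V] [DecidableEq V]
    {X : Matrix V V ℂ} {a b : V} {c γ : ℂ} (hγ : γ ≠ 0) (hX : X.IsSymm)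
    (ha : NormedSpace.exp (c • X) *ᵥ Pi.single a 1 = γ • Pi.single b 1)
    (hb : NormedSpace.exp (c • X) *ᵥ Pi.single b 1 = γ • Pi.single a 1) (n : ℕ) :
    (X ^ n) a a = (X ^ n) b b := by
  have hcomm : Commute (NormedSpace.exp (c • X)) (X ^ n) :=
    (((Commute.refl X).smul_left c).exp_left).pow_right n
  have h := exp_smul_mulVec_dotProduct hX c (Pi.single b 1) (X ^ n *ᵥ Pi.single a 1)
  rw [Matrix.mulVec_mulVec, hcomm.eq, ← Matrix.mulVec_mulVec, ha, hb] at h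
  simpa [Matrix.mulVec_smul, hγ] using h

open Matrix in
theorem exp_mul_apply_eq_of_exp_mulVec_single {V : Type*} [Fintype V] [DecidableEq V]
    {X : Matrix V V ℂ} {a b : V} {c γ : ℂ} (hX : X.IsSymm)
    (hb : NormedSpace.exp (c • X) *ᵥ Pi.single b 1 = γ • Pi.single a 1)
    {x : V → ℂ} {z : ℂ} (hx : X *ᵥ x = z • x) : Complex.exp (c * z) * x b = γ * x a := by
  have hcx : (c • X) *ᵥ x = (c * z) • x := by rw [Matrix.smul_mulVec, hx, smul_smul]
  have h := exp_smul_mulVec_dotProduct hX c (Pi.single b 1) x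
  rw [hb, exp_mulVec_of_mulVec_eq_smul hcx] at h
  simpa using h.symm

/-! ### Spectral decomposition and moments -/

open Matrix in
/-- A real symmetric matrix has an orthonormal basis of eigenvectors. -/
theorem exists_orthonormal_eigenvectors {V : Type*} [Fintype V] [DecidableEq V]
    {X : Matrix V V ℝ} (hX : X.IsSymm) :
    ∃ (lam : V → ℝ) (u : V → V → ℝ), (∀ j, X *ᵥ u j = lam j • u j) ∧
      ∀ p q, ∑ j, u j p * u j q = (1 : Matrix V V ℝ) p q := by
  have hH : X.IsHermitian := by
    rw [Matrix.IsHermitian, Matrix.conjTranspose_eq_transpose_of_trivial, hX.eq]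
  refine ⟨hH.eigenvalues, fun j => ⇑(hH.eigenvectorBasis j), hH.mulVec_eigenvectorBasis,
    fun p q => ?_⟩
  have h : (hH.eigenvectorUnitary : Matrix V V ℝ) *
      star (hH.eigenvectorUnitary : Matrix V V ℝ) = 1 :=
    Unitary.coe_mul_star_self _
  rw [← h, Matrix.mul_apply]
  simp [Matrix.star_apply]

open Matrix in
theorem sum_pow_eigenvalue_mul {V : Type*} [Fintype V] [DecidableEq V]
    {X : Matrix V V ℝ} {lam : V → ℝ} {u : V → V → ℝ} (hu : ∀ j, X *ᵥ u j = lam j • u j)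
    (hc : ∀ p q, ∑ j, u j p * u j q = (1 : Matrix V V ℝ) p q) (n : ℕ) (p q : V) :
    ∑ j, lam j ^ n * (u j p * u j q) = (X ^ n) p q := by
  induction n generalizing p with
  | zero => simp [hc]
  | succ n ih =>
    have h : ∀ j, lam j * u j p = ∑ r, X p r * u j r := fun j => (congrFun (hu j) p).symm
    calc ∑ j, lam j ^ (n + 1) * (u j p * u j q)
        = ∑ j, ∑ r, X p r * (lam j ^ n * (u j r * u j q)) := by
          refine Finset.sum_congr rfl fun j _ => ?_
          rw [pow_succ, show lam j ^ n * lam j * (u j p * u j q)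
            = lam j ^ n * u j q * (lam j * u j p) by ring, h, Finset.mul_sum]
          exact Finset.sum_congr rfl fun r _ => by ring
      _ = (X ^ (n + 1)) p q := by
          rw [Finset.sum_comm, pow_succ', Matrix.mul_apply]
          exact Finset.sum_congr rfl fun r _ => by rw [← Finset.mul_sum, ih]

/-! ### Walks in Z and in its branches -/

theorem twoBridgeGraph_adj {V₁ V₂ : Type*} {Y₁ : SimpleGraph V₁} {Y₂ : SimpleGraph V₂} {a : V₁}
    {b : V₂} {p q : V₁ ⊕ Unit ⊕ V₂} :
    (twoBridgeGraph Y₁ a Y₂ b).Adj p q ↔ twoBridgeAdj Y₁ a Y₂ b p q := Iff.rfl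

open Matrix in
theorem adjMatrix_twoBridgeGraph_mulVec_inl {V₁ V₂ : Type*} [Fintype V₁] [Fintype V₂]
    {Y₁ : SimpleGraph V₁} {Y₂ : SimpleGraph V₂} {a : V₁} {b : V₂}
    [DecidableRel (twoBridgeGraph Y₁ a Y₂ b).Adj] [DecidableEq V₁] [DecidableRel Y₁.Adj]
    {R : Type*} [CommRing R] (x : V₁ ⊕ Unit ⊕ V₂ → R) (u : V₁) :
    ((twoBridgeGraph Y₁ a Y₂ b).adjMatrix R *ᵥ x) (Sum.inl u) =
      (Y₁.adjMatrix R *ᵥ (x ∘ Sum.inl)) u + if u = a then x (Sum.inr (Sum.inl ())) else 0 := by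
  simp [Matrix.mulVec, dotProduct, SimpleGraph.adjMatrix_apply, twoBridgeGraph_adj, twoBridgeAdj]

open Matrix in
theorem adjMatrix_twoBridgeGraph_mulVec_middle {V₁ V₂ : Type*} [Fintype V₁] [Fintype V₂]
    {Y₁ : SimpleGraph V₁} {Y₂ : SimpleGraph V₂} {a : V₁} {b : V₂}
    [DecidableRel (twoBridgeGraph Y₁ a Y₂ b).Adj] [DecidableEq V₁] [DecidableEq V₂]
    {R : Type*} [CommRing R] (x : V₁ ⊕ Unit ⊕ V₂ → R) :
    ((twoBridgeGraph Y₁ a Y₂ b).adjMatrix R *ᵥ x) (Sum.inr (Sum.inl ())) =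
      x (Sum.inl a) + x (Sum.inr (Sum.inr b)) := by
  simp [Matrix.mulVec, dotProduct, SimpleGraph.adjMatrix_apply, twoBridgeGraph_adj, twoBridgeAdj]

open Matrix in
theorem adjMatrix_twoBridgeGraph_mulVec_inr {V₁ V₂ : Type*} [Fintype V₁] [Fintype V₂]
    {Y₁ : SimpleGraph V₁} {Y₂ : SimpleGraph V₂} {a : V₁} {b : V₂}
    [DecidableRel (twoBridgeGraph Y₁ a Y₂ b).Adj] [DecidableEq V₂] [DecidableRel Y₂.Adj]
    {R : Type*} [CommRing R] (x : V₁ ⊕ Unit ⊕ V₂ → R) (u : V₂) :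
    ((twoBridgeGraph Y₁ a Y₂ b).adjMatrix R *ᵥ x) (Sum.inr (Sum.inr u)) =
      (Y₂.adjMatrix R *ᵥ (x ∘ Sum.inr ∘ Sum.inr)) u +
        if u = b then x (Sum.inr (Sum.inl ())) else 0 := by
  simp [Matrix.mulVec, dotProduct, SimpleGraph.adjMatrix_apply, twoBridgeGraph_adj, twoBridgeAdj,
    add_comm]

section TwoBridge

open Matrix

variable {V₁ V₂ : Type*} [Fintype V₁] [Fintype V₂] [DecidableEq V₁] [DecidableEq V₂]
  {Y₁ : SimpleGraph V₁} {Y₂ : SimpleGraph V₂} [DecidableRel Y₁.Adj] [DecidableRel Y₂.Adj]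
  {a : V₁} {b : V₂} [DecidableRel (twoBridgeGraph Y₁ a Y₂ b).Adj]
  {R : Type*} [CommRing R]

/-- If `a` and `b` are cospectral, then the walks from `e_a - e_b` never enter the middle vertex. -/
theorem adjMatrix_twoBridgeGraph_pow_mulVec
    (hcos : ∀ n : ℕ, ((twoBridgeGraph Y₁ a Y₂ b).adjMatrix R ^ n) (Sum.inl a) (Sum.inl a) =
      ((twoBridgeGraph Y₁ a Y₂ b).adjMatrix R ^ n) (Sum.inr (Sum.inr b)) (Sum.inr (Sum.inr b)))
    (n : ℕ) :
    (twoBridgeGraph Y₁ a Y₂ b).adjMatrix R ^ n *ᵥ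
        (Pi.single (Sum.inl a) 1 - Pi.single (Sum.inr (Sum.inr b)) 1) =
      Sum.elim (Y₁.adjMatrix R ^ n *ᵥ Pi.single a 1)
        (Sum.elim (0 : Unit → R) (-(Y₂.adjMatrix R ^ n *ᵥ Pi.single b 1))) := by
  induction n with
  | zero =>
    ext (u | u | u) <;> simp [Pi.single_apply, Matrix.one_apply]
  | succ n ih =>
    -- The next middle coordinate is this difference. By the induction hypothesis it comes from
    -- diagonal entries, equal by `hcos`, and cross entries, equal by symmetry.
    have hmid : (Y₁.adjMatrix R ^ n) a a - (Y₂.adjMatrix R ^ n) b b = 0 := by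
      have hs : ∀ p q, ((twoBridgeGraph Y₁ a Y₂ b).adjMatrix R ^ n) p q =
          ((twoBridgeGraph Y₁ a Y₂ b).adjMatrix R ^ n) q p := fun p q =>
        ((SimpleGraph.isSymm_adjMatrix (α := R) (twoBridgeGraph Y₁ a Y₂ b)).pow n).apply q p
      have h1 := congrFun ih (Sum.inl a)
      have h2 := congrFun ih (Sum.inr (Sum.inr b))
      simp [Matrix.mulVec_sub] at h1 h2
      rw [← h1]
      have h3 := hs (Sum.inl a) (Sum.inr (Sum.inr b))
      have h4 := hcos n
      linear_combination -h2 - h3 + h4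
    rw [pow_succ', ← Matrix.mulVec_mulVec, ih]
    ext (u | u | u)
    · rw [adjMatrix_twoBridgeGraph_mulVec_inl]
      simp [Function.comp_def, pow_succ']
    · rw [adjMatrix_twoBridgeGraph_mulVec_middle]
      simpa [sub_eq_add_neg] using hmid
    · rw [adjMatrix_twoBridgeGraph_mulVec_inr]
      have : ((Sum.elim (Y₁.adjMatrix R ^ n *ᵥ Pi.single a 1)
        (Sum.elim (0 : Unit → R) (-(Y₂.adjMatrix R ^ n *ᵥ Pi.single b 1)))) ∘ Sum.inr ∘ Sum.inr :
          V₂ → R) =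
          -(Y₂.adjMatrix R ^ n *ᵥ Pi.single b 1) := rfl
      rw [this, Matrix.mulVec_neg, Matrix.mulVec_mulVec, ← pow_succ']
      simp

/-- The transition matrix of the first branch fixes `e_a` up to a phase. -/
theorem exp_adjMatrix_mulVec_single_of_twoBridgeGraph {c γ : ℂ} (hγ : γ ≠ 0)
    (ha : NormedSpace.exp (c • (twoBridgeGraph Y₁ a Y₂ b).adjMatrix ℂ) *ᵥ
      Pi.single (Sum.inl a) 1 = γ • Pi.single (Sum.inr (Sum.inr b)) 1)
    (hb : NormedSpace.exp (c • (twoBridgeGraph Y₁ a Y₂ b).adjMatrix ℂ) *ᵥ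
      Pi.single (Sum.inr (Sum.inr b)) 1 = γ • Pi.single (Sum.inl a) 1) :
    NormedSpace.exp (c • Y₁.adjMatrix ℂ) *ᵥ Pi.single a 1 = (-γ) • Pi.single a 1 := by
  have hpow := adjMatrix_twoBridgeGraph_pow_mulVec (Y₁ := Y₁) (Y₂ := Y₂) (a := a) (b := b)
    (pow_apply_eq_of_exp_mulVec_single hγ (SimpleGraph.isSymm_adjMatrix _) ha hb)
  ext u
  have h1 := hasSum_exp_mulVec_apply (c • Y₁.adjMatrix ℂ) (Pi.single a 1) u
  have h2 := hasSum_exp_mulVec_apply (c • (twoBridgeGraph Y₁ a Y₂ b).adjMatrix ℂ)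
    (Pi.single (Sum.inl a) 1 - Pi.single (Sum.inr (Sum.inr b)) 1) (Sum.inl u)
  simp only [smul_pow, Matrix.smul_mulVec, hpow] at h2
  simp only [smul_pow, Matrix.smul_mulVec] at h1
  rw [h1.unique h2, Matrix.mulVec_sub, ha, hb]
  simp [Pi.single_apply, neg_ite]

/-- This is the vanishing of the middle coordinate after n + 1 steps. -/
theorem adjMatrix_pow_apply_eq_of_twoBridgeGraph
    (hcos : ∀ n : ℕ, ((twoBridgeGraph Y₁ a Y₂ b).adjMatrix R ^ n) (Sum.inl a) (Sum.inl a) =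
      ((twoBridgeGraph Y₁ a Y₂ b).adjMatrix R ^ n) (Sum.inr (Sum.inr b)) (Sum.inr (Sum.inr b)))
    (n : ℕ) : (Y₁.adjMatrix R ^ n) a a = (Y₂.adjMatrix R ^ n) b b := by
  have h := congrFun (adjMatrix_twoBridgeGraph_pow_mulVec hcos (n + 1)) (Sum.inr (Sum.inl ()))
  rw [pow_succ', ← Matrix.mulVec_mulVec, adjMatrix_twoBridgeGraph_pow_mulVec hcos n,
    adjMatrix_twoBridgeGraph_mulVec_middle] at h
  simpa [← sub_eq_add_neg, sub_eq_zero] using h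

end TwoBridge

/-! ### Real eigenvectors and inequalities for weighted eigenvalues -/

open Matrix in
theorem HasUnitEigenvector.of_real {V : Type*} [Fintype V] {G : SimpleGraph V}
    [DecidableRel G.Adj] {a b : V} {u : V → ℝ} {r : ℝ} (hu : G.adjMatrix ℝ *ᵥ u = r • u)
    (ha : u a ≠ 0) (hb : u b = u a) : HasUnitEigenvector G a b (r : ℂ) := by
  refine ⟨fun i => ((u i / u a : ℝ) : ℂ), ?_, by simp [ha], by simp [ha, hb]⟩
  ext i
  have h := congrFun hu i
  rw [SimpleGraph.adjMatrix_mulVec_apply, Pi.smul_apply, smul_eq_mul] at h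
  rw [SimpleGraph.adjMatrix_mulVec_apply, Pi.smul_apply, smul_eq_mul, ← Complex.ofReal_sum,
    ← Finset.sum_div, h, mul_div_assoc, Complex.ofReal_mul]

/-- Each 1/(m - λ_i) is at most 1/d, so m ≤ 2/d. Equality would make λ constant on the support,
equal to its mean 0, against positive variance. -/
theorem lt_two_div_of_eq_two_mul_sum {ι : Type*} [Fintype ι] {w lam : ι → ℝ} {m d : ℝ}
    (hw : ∀ i, 0 ≤ w i) (hw1 : ∑ i, w i = 1) (hmean : ∑ i, lam i * w i = 0)
    (hvar : 0 < ∑ i, lam i ^ 2 * w i) (hd : 0 < d) (hgap : ∀ i, w i ≠ 0 → d ≤ |m - lam i|)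
    (hm : m = 2 * ∑ i, w i / (m - lam i)) : m < 2 / d := by
  by_contra! h
  have hsum : ∑ i, w i * (1 / d - 1 / (m - lam i)) ≤ 0 := by
    have : ∑ i, w i * (1 / d - 1 / (m - lam i)) = 1 / d - ∑ i, w i / (m - lam i) := by
      simp only [mul_sub, mul_one_div, Finset.sum_sub_distrib, ← Finset.sum_div, hw1]
    have h2 : 2 / d = 2 * (1 / d) := by ring
    rw [this]
    linarith
  have hterm : ∀ i, 0 ≤ w i * (1 / d - 1 / (m - lam i)) := by
    intro i
    rcases eq_or_ne (w i) 0 with h0 | h0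
    · simp [h0]
    · refine mul_nonneg (hw i) (sub_nonneg.2 ((le_abs_self _).trans ?_))
      rw [abs_div, abs_one]
      exact one_div_le_one_div_of_le hd (hgap i h0)
  have hzero := (Finset.sum_eq_zero_iff_of_nonneg fun i _ => hterm i).1
    (le_antisymm hsum (Finset.sum_nonneg fun i _ => hterm i))
  have hlam : ∀ i, lam i * w i = (m - d) * w i := by
    intro i
    rcases mul_eq_zero.1 (hzero i (Finset.mem_univ i)) with h0 | h0
    · simp [h0]
    · have h1 : d = m - lam i := by
        rw [one_div, one_div, sub_eq_zero] at h0
        exact inv_injective h0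
      rw [h1]
      ring
  have hmd : m - d = 0 := by
    rw [← hmean, Finset.sum_congr rfl fun i _ => hlam i, ← Finset.mul_sum, hw1, mul_one]
  refine hvar.ne' (Finset.sum_eq_zero fun i _ => ?_)
  rw [sq, mul_assoc, hlam, hmd]
  ring

theorem abs_lt_two_div_of_eq_two_mul_sum {ι : Type*} [Fintype ι] {w lam : ι → ℝ} {m d : ℝ}
    (hw : ∀ i, 0 ≤ w i) (hw1 : ∑ i, w i = 1) (hmean : ∑ i, lam i * w i = 0)
    (hvar : 0 < ∑ i, lam i ^ 2 * w i) (hd : 0 < d) (hgap : ∀ i, w i ≠ 0 → d ≤ |m - lam i|)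
    (hm : m = 2 * ∑ i, w i / (m - lam i)) : |m| < 2 / d := by
  refine abs_lt.2 ⟨?_, lt_two_div_of_eq_two_mul_sum hw hw1 hmean hvar hd hgap hm⟩
  rw [neg_lt]
  refine lt_two_div_of_eq_two_mul_sum (w := w) (lam := fun i => -lam i) hw hw1
    (by simpa using hmean) (by simpa using hvar) hd (fun i hi => ?_) ?_
  · rw [← abs_neg]
    convert hgap i hi using 2
    ring
  · have : ∀ i, w i / (-m - -lam i) = -(w i / (m - lam i)) := fun i => by
      rw [← div_neg]; ring_nf
    simp only [this, Finset.sum_neg_distrib]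
    linarith

/-- A centred distribution on a progression of difference at least two, within a short interval,
has small variance. -/
theorem variance_lt_three_of_progression {ι : Type*} [Fintype ι] {v lam : ι → ℝ} {d : ℝ}
    (hv : ∀ i, 0 ≤ v i) (hv1 : ∑ i, v i = 1) (hmean : ∑ i, lam i * v i = 0) (hd : 1 ≤ d)
    (hlt : ∀ i, v i ≠ 0 → |lam i| < 2 / d)
    (hprog : ∀ i j, v i ≠ 0 → v j ≠ 0 → ∃ n : ℤ, lam i - lam j = 2 * n * d) :
    ∑ i, lam i ^ 2 * v i < 3 := by
  have hd0 : 0 < d := by linarith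
  by_contra! h3
  have hupper : ∑ i, lam i ^ 2 * v i ≤ (2 / d) ^ 2 := by
    rw [← mul_one ((2 / d) ^ 2), ← hv1, Finset.mul_sum]
    refine Finset.sum_le_sum fun i _ => ?_
    rcases eq_or_ne (v i) 0 with h0 | h0
    · simp [h0]
    · exact mul_le_mul_of_nonneg_right (sq_le_sq' (abs_lt.1 (hlt i h0)).1.le
        (abs_lt.1 (hlt i h0)).2.le) (hv i)
  have hne : ({i | v i ≠ 0} : Finset ι).Nonempty := by
    by_contra! h0
    have : ∀ i, v i = 0 := by
      intro i
      by_contra hi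
      have : i ∈ ({i | v i ≠ 0} : Finset ι) := by simp [hi]
      simp [h0] at this
    simp [this] at hv1
  obtain ⟨k, hk, hmin⟩ := Finset.exists_min_image _ lam hne
  have hk' : v k ≠ 0 := by simpa using hk
  have hdd : 2 / d ≤ 2 * d := by
    rw [div_le_iff₀ hd0]
    nlinarith
  -- On the support only lam k and lam k + 2d occur, so lam i is a root of a fixed quadratic.
  have hq : ∀ i, lam i ^ 2 * v i =
      (2 * lam k + 2 * d) * (lam i * v i) - lam k * (lam k + 2 * d) * v i := by
    intro i
    rcases eq_or_ne (v i) 0 with h0 | h0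
    · simp [h0]
    obtain ⟨n, hn⟩ := hprog i k h0 hk'
    have h1 := hmin i (by simpa using h0)
    have h2 := abs_lt.1 (hlt i h0)
    have h3 := abs_lt.1 (hlt k hk')
    have hn0 : 0 ≤ n := by
      by_contra! hneg
      have : (n : ℝ) ≤ -1 := by exact_mod_cast Int.le_sub_one_of_lt hneg
      nlinarith
    -- The spread is strictly below 4/d ≤ 4d; strictness excludes n = 2.
    have hn2 : n < 2 := by
      by_contra! hbig
      have : (2 : ℝ) ≤ n := by exact_mod_cast hbig
      nlinarith
    have : (lam i - lam k) * (lam i - lam k - 2 * d) = 0 := by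
      interval_cases n
      · simp at hn; simp [hn]
      · simp at hn; simp [hn]
    linear_combination v i * this
  have hvar : ∑ i, lam i ^ 2 * v i = -(lam k * (lam k + 2 * d)) := by
    rw [Finset.sum_congr rfl fun i _ => hq i, Finset.sum_sub_distrib, ← Finset.mul_sum,
      ← Finset.mul_sum, hmean, hv1]
    ring
  have h4 : (2 / d) ^ 2 * d ^ 2 = 4 := by field_simp; norm_num
  -- The variance equals d² - (lam k + d)², so it is at most d². It is also at most 4/d², and both
  -- cannot reach 3.
  have h5 : 3 ≤ d ^ 2 := by nlinarith [sq_nonneg (lam k + d)]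
  nlinarith

/-! ### Second moments and the secular equation -/

section TwoBridge

open Matrix

variable {V₁ V₂ : Type*} [Fintype V₁] [Fintype V₂] [DecidableEq V₁] [DecidableEq V₂]
  {Y₁ : SimpleGraph V₁} {Y₂ : SimpleGraph V₂} [DecidableRel Y₁.Adj]
  {a : V₁} {b : V₂} [DecidableRel (twoBridgeGraph Y₁ a Y₂ b).Adj]

theorem adjMatrix_twoBridgeGraph_sq_apply_left :
    ((twoBridgeGraph Y₁ a Y₂ b).adjMatrix ℝ ^ 2) (Sum.inl a) (Sum.inl a) = Y₁.degree a + 1 := by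
  have h0 : ((twoBridgeGraph Y₁ a Y₂ b).adjMatrix ℝ *ᵥ Pi.single (Sum.inl a) 1) ∘ Sum.inl =
      Y₁.adjMatrix ℝ *ᵥ Pi.single a 1 := by
    ext u
    simp [SimpleGraph.adjMatrix_apply, twoBridgeGraph_adj, twoBridgeAdj]
  have h : ((twoBridgeGraph Y₁ a Y₂ b).adjMatrix ℝ *ᵥ ((twoBridgeGraph Y₁ a Y₂ b).adjMatrix ℝ *ᵥ
      Pi.single (Sum.inl a) 1)) (Sum.inl a) = Y₁.degree a + 1 := by
    rw [adjMatrix_twoBridgeGraph_mulVec_inl, adjMatrix_twoBridgeGraph_mulVec_middle, h0,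
      Matrix.mulVec_mulVec, Matrix.mulVec_single_one, Matrix.col_apply,
      SimpleGraph.adjMatrix_mul_self_apply_self]
    simp
  rw [Matrix.mulVec_mulVec] at h
  simpa [sq] using h

theorem adjMatrix_twoBridgeGraph_sq_apply_left_right :
    ((twoBridgeGraph Y₁ a Y₂ b).adjMatrix ℝ ^ 2) (Sum.inl a) (Sum.inr (Sum.inr b)) = 1 := by
  have h0 : ((twoBridgeGraph Y₁ a Y₂ b).adjMatrix ℝ *ᵥ Pi.single (Sum.inr (Sum.inr b)) 1) ∘
      Sum.inl = 0 := by
    ext u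
    simp [SimpleGraph.adjMatrix_apply, twoBridgeGraph_adj, twoBridgeAdj]
  have h : ((twoBridgeGraph Y₁ a Y₂ b).adjMatrix ℝ *ᵥ ((twoBridgeGraph Y₁ a Y₂ b).adjMatrix ℝ *ᵥ
      Pi.single (Sum.inr (Sum.inr b)) 1)) (Sum.inl a) = 1 := by
    rw [adjMatrix_twoBridgeGraph_mulVec_inl, adjMatrix_twoBridgeGraph_mulVec_middle, h0]
    simp
  rw [Matrix.mulVec_mulVec] at h
  simpa [sq] using h

/-- The secular equation for the eigenvalues of eigenvectors that agree at `a` and `b`. -/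
theorem eq_two_mul_sum_div_of_twoBridgeGraph {x : V₁ ⊕ Unit ⊕ V₂ → ℝ} {m : ℝ}
    (hx : (twoBridgeGraph Y₁ a Y₂ b).adjMatrix ℝ *ᵥ x = m • x)
    (hab : x (Sum.inr (Sum.inr b)) = x (Sum.inl a)) (ha : x (Sum.inl a) ≠ 0)
    {lam : V₁ → ℝ} {u : V₁ → V₁ → ℝ} (hu : ∀ j, Y₁.adjMatrix ℝ *ᵥ u j = lam j • u j)
    (hc : ∀ p q, ∑ j, u j p * u j q = (1 : Matrix V₁ V₁ ℝ) p q)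
    (hne : ∀ j, u j a ≠ 0 → m ≠ lam j) :
    m = 2 * ∑ j, u j a * u j a / (m - lam j) := by
  set y : V₁ → ℝ := x ∘ Sum.inl with hy
  set s := x (Sum.inr (Sum.inl ())) with hs
  have hmid : 2 * x (Sum.inl a) = m * s := by
    have h := congrFun hx (Sum.inr (Sum.inl ()))
    rw [adjMatrix_twoBridgeGraph_mulVec_middle, hab] at h
    simp only [Pi.smul_apply, smul_eq_mul] at h
    linarith
  have hleft : Y₁.adjMatrix ℝ *ᵥ y + s • Pi.single a 1 = m • y := by
    ext v
    have h := congrFun hx (Sum.inl v)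
    rw [adjMatrix_twoBridgeGraph_mulVec_inl] at h
    simpa [Pi.single_apply, hy, hs] using h
  -- Pairing with u j diagonalises the equation on Y₁ and determines the coefficients of y.
  have hdot : ∀ j, (m - lam j) * (u j ⬝ᵥ y) = s * u j a := by
    intro j
    have h := congrArg (fun z => u j ⬝ᵥ z) hleft
    have h2 : u j ⬝ᵥ (Y₁.adjMatrix ℝ *ᵥ y) = lam j * (u j ⬝ᵥ y) := by
      rw [Matrix.dotProduct_mulVec, ← Matrix.mulVec_transpose, SimpleGraph.transpose_adjMatrix,
        hu, smul_dotProduct, smul_eq_mul]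
    simp only [dotProduct_add, h2, dotProduct_smul, dotProduct_single_one, smul_eq_mul] at h
    linarith
  have hexp : x (Sum.inl a) = ∑ j, u j a * (u j ⬝ᵥ y) := by
    have : ∑ j, u j a * (u j ⬝ᵥ y) = ∑ v, (∑ j, u j a * u j v) * y v := by
      simp only [dotProduct, Finset.mul_sum, Finset.sum_mul]
      rw [Finset.sum_comm]
      exact Finset.sum_congr rfl fun _ _ => Finset.sum_congr rfl fun _ _ => by ring
    rw [this]
    simp [hc, Matrix.one_apply, hy]
  have hsum : x (Sum.inl a) = s * ∑ j, u j a * u j a / (m - lam j) := by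
    rw [hexp, Finset.mul_sum]
    refine Finset.sum_congr rfl fun j _ => ?_
    rcases eq_or_ne (u j a) 0 with h0 | h0
    · simp [h0]
    · have : m - lam j ≠ 0 := sub_ne_zero.2 (hne j h0)
      field_simp
      linarith [hdot j]
  refine mul_right_cancel₀ ha ?_
  rw [mul_right_comm, hmid, mul_assoc, ← hsum]

end TwoBridge

/-! ### Odd differences and the vanishing of the degree -/

theorem exists_int_mul_pi_div_of_exp_eq_neg {t : ℝ} (ht : t ≠ 0) {z w : ℂ}
    (h : Complex.exp (Complex.I * t * z) = -Complex.exp (Complex.I * t * w)) :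
    ∃ n : ℤ, Odd n ∧ z - w = n * ((Real.pi / t : ℝ) : ℂ) := by
  have h1 : Complex.exp (Complex.I * t * z) =
      Complex.exp (Complex.I * t * w + Real.pi * Complex.I) := by
    rw [Complex.exp_add, Complex.exp_pi_mul_I, h]
    ring
  obtain ⟨n, hn⟩ := Complex.exp_eq_exp_iff_exists_int.1 h1
  refine ⟨2 * n + 1, odd_two_mul_add_one n, ?_⟩
  have ht' : (t : ℂ) ≠ 0 := by exact_mod_cast ht
  have h2 : (t : ℂ) * (z - w) = (2 * n + 1) * Real.pi := by
    refine mul_left_cancel₀ Complex.I_ne_zero ?_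
    linear_combination hn
  push_cast
  rw [← mul_div_assoc, eq_div_iff ht', ← h2]
  ring

open Matrix in
/-- Eigenvectors take equal or opposite values at the vertices of perfect state transfer. -/
theorem sq_apply_eq_of_exp_mulVec_single {V : Type*} [Fintype V] [DecidableEq V]
    {G : SimpleGraph V} [DecidableRel G.Adj] {a b : V} {c γ : ℂ} (hγ : γ ≠ 0)
    (ha : NormedSpace.exp (c • G.adjMatrix ℂ) *ᵥ Pi.single a 1 = γ • Pi.single b 1)
    (hb : NormedSpace.exp (c • G.adjMatrix ℂ) *ᵥ Pi.single b 1 = γ • Pi.single a 1)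
    {x : V → ℝ} {r : ℝ} (hx : G.adjMatrix ℝ *ᵥ x = r • x) : x b ^ 2 = x a ^ 2 := by
  have hxc : G.adjMatrix ℂ *ᵥ (fun i => (x i : ℂ)) = (r : ℂ) • fun i => (x i : ℂ) := by
    ext i
    have h := congrFun hx i
    rw [SimpleGraph.adjMatrix_mulVec_apply, Pi.smul_apply, smul_eq_mul] at h
    rw [SimpleGraph.adjMatrix_mulVec_apply, Pi.smul_apply, smul_eq_mul, ← Complex.ofReal_sum, h,
      Complex.ofReal_mul]
  have h1 := exp_mul_apply_eq_of_exp_mulVec_single (SimpleGraph.isSymm_adjMatrix G) hb hxc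
  have h2 := exp_mul_apply_eq_of_exp_mulVec_single (SimpleGraph.isSymm_adjMatrix G) ha hxc
  have h3 : (x b : ℂ) ^ 2 = (x a : ℂ) ^ 2 := by
    refine mul_left_cancel₀ (mul_ne_zero hγ (Complex.exp_ne_zero (c * r))) ?_
    linear_combination γ * (x b : ℂ) * h1 - γ * (x a : ℂ) * h2
  exact_mod_cast h3

section TwoBridge

open Matrix

variable {V₁ V₂ : Type*} [Fintype V₁] [Fintype V₂] [DecidableEq V₁] [DecidableEq V₂]
  {Y₁ : SimpleGraph V₁} {Y₂ : SimpleGraph V₂} [DecidableRel Y₁.Adj] [DecidableRel Y₂.Adj]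
  {a : V₁} {b : V₂} [DecidableRel (twoBridgeGraph Y₁ a Y₂ b).Adj]

theorem degree_eq_zero_of_exp_twoBridgeGraph {t : ℝ} {γ : ℂ} (ht : 0 < t) (hγ : γ ≠ 0)
    (ha : NormedSpace.exp ((Complex.I * (t : ℂ)) • (twoBridgeGraph Y₁ a Y₂ b).adjMatrix ℂ) *ᵥ
      Pi.single (Sum.inl a) 1 = γ • Pi.single (Sum.inr (Sum.inr b)) 1)
    (hb : NormedSpace.exp ((Complex.I * (t : ℂ)) • (twoBridgeGraph Y₁ a Y₂ b).adjMatrix ℂ) *ᵥ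
      Pi.single (Sum.inr (Sum.inr b)) 1 = γ • Pi.single (Sum.inl a) 1) :
    Y₁.degree a = 0 := by
  by_contra hdeg
  have hdeg1 : (1 : ℝ) ≤ Y₁.degree a := by exact_mod_cast Nat.one_le_iff_ne_zero.2 hdeg
  have hsymm := SimpleGraph.isSymm_adjMatrix (α := ℂ) (twoBridgeGraph Y₁ a Y₂ b)
  obtain ⟨mu, x, hx, hxc⟩ := exists_orthonormal_eigenvectors
    (SimpleGraph.isSymm_adjMatrix (α := ℝ) (twoBridgeGraph Y₁ a Y₂ b))
  obtain ⟨lam, u, hu, huc⟩ := exists_orthonormal_eigenvectors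
    (SimpleGraph.isSymm_adjMatrix (α := ℝ) Y₁)
  have hxpow := sum_pow_eigenvalue_mul hx hxc
  have hupow := sum_pow_eigenvalue_mul hu huc
  have hsq : ∀ j, x j (Sum.inr (Sum.inr b)) ^ 2 = x j (Sum.inl a) ^ 2 := fun j =>
    sq_apply_eq_of_exp_mulVec_single hγ ha hb (hx j)
  have hcases : ∀ j, x j (Sum.inl a) * (x j (Sum.inl a) + x j (Sum.inr (Sum.inr b))) ≠ 0 →
      x j (Sum.inl a) ≠ 0 ∧ x j (Sum.inr (Sum.inr b)) = x j (Sum.inl a) := by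
    intro j hj
    refine ⟨left_ne_zero_of_mul hj, ?_⟩
    rcases sq_eq_sq_iff_eq_or_eq_neg.1 (hsq j) with h | h
    · exact h
    · simp [h] at hj
  -- These weights are 2 x_a² when the values at a and b agree and 0 when they are opposite. Their
  -- moments are (A^n)_aa + (A^n)_ab.
  set v : V₁ ⊕ Unit ⊕ V₂ → ℝ := fun j =>
    x j (Sum.inl a) * (x j (Sum.inl a) + x j (Sum.inr (Sum.inr b))) with hv
  have hv0 : ∀ j, 0 ≤ v j := by
    intro j
    rcases sq_eq_sq_iff_eq_or_eq_neg.1 (hsq j) with h | h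
    · simp only [hv, h]; nlinarith [sq_nonneg (x j (Sum.inl a))]
    · simp [hv, h]
  have hvpow : ∀ n, ∑ j, mu j ^ n * v j =
      ((twoBridgeGraph Y₁ a Y₂ b).adjMatrix ℝ ^ n) (Sum.inl a) (Sum.inl a) +
      ((twoBridgeGraph Y₁ a Y₂ b).adjMatrix ℝ ^ n) (Sum.inl a) (Sum.inr (Sum.inr b)) := by
    intro n
    rw [← hxpow, ← hxpow, ← Finset.sum_add_distrib]
    exact Finset.sum_congr rfl fun j _ => by simp only [hv]; ring
  have hv1 : ∑ j, v j = 1 := by simpa using hvpow 0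
  have hvmean : ∑ j, mu j * v j = 0 := by
    simpa [SimpleGraph.adjMatrix_apply, twoBridgeGraph_adj, twoBridgeAdj] using hvpow 1
  have hvvar : ∑ j, mu j ^ 2 * v j = Y₁.degree a + 2 := by
    rw [hvpow 2, adjMatrix_twoBridgeGraph_sq_apply_left,
      adjMatrix_twoBridgeGraph_sq_apply_left_right]
    ring
  have hw1 : ∑ j, u j a * u j a = 1 := by simpa using hupow 0 a a
  have hwmean : ∑ j, lam j * (u j a * u j a) = 0 := by simpa using hupow 1 a a
  have hwvar : ∑ j, lam j ^ 2 * (u j a * u j a) = Y₁.degree a := by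
    rw [hupow 2, sq, SimpleGraph.adjMatrix_mul_self_apply_self]
  have hS : ∀ j, v j ≠ 0 →
      HasUnitEigenvector (twoBridgeGraph Y₁ a Y₂ b) (Sum.inl a) (Sum.inr (Sum.inr b)) (mu j) :=
    fun j hj => HasUnitEigenvector.of_real (hx j) (hcases j hj).1 (hcases j hj).2
  -- With a repeated, the normalisation only asks for a nonzero value at a.
  have hT : ∀ j, u j a ≠ 0 → HasUnitEigenvector Y₁ a a (lam j) := fun j hj =>
    HasUnitEigenvector.of_real (hu j) hj rfl
  -- differences of the two kinds of eigenvalues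
  let D : Set ℂ := {z | ∃ p q : ℂ,
    HasUnitEigenvector (twoBridgeGraph Y₁ a Y₂ b) (Sum.inl a) (Sum.inr (Sum.inr b)) p ∧
    HasUnitEigenvector Y₁ a a q ∧ z = p - q}
  have hY := exp_adjMatrix_mulVec_single_of_twoBridgeGraph hγ ha hb
  have hDodd : ∀ z ∈ D, ∃ n : ℤ, Odd n ∧ z = n * ((Real.pi / t : ℝ) : ℂ) := by
    rintro z ⟨p, q, ⟨f, hf, hfa, hfb⟩, ⟨g, hg, hga, -⟩, rfl⟩
    have h1 := exp_mul_apply_eq_of_exp_mulVec_single hsymm hb hf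
    have h2 := exp_mul_apply_eq_of_exp_mulVec_single (SimpleGraph.isSymm_adjMatrix (α := ℂ) Y₁)
      hY hg
    rw [hfa, hfb, mul_one, mul_one] at h1
    rw [hga, mul_one, mul_one] at h2
    exact exists_int_mul_pi_div_of_exp_eq_neg ht.ne' (by rw [h1, h2, neg_neg])
  have hvne : ∃ j, v j ≠ 0 := by
    by_contra! h0
    simp [h0] at hv1
  have hune : ∃ j, u j a ≠ 0 := by
    by_contra! h0
    simp [h0] at hw1
  obtain ⟨j₀, hj₀⟩ := hvne
  obtain ⟨k₀, hk₀⟩ := hune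
  obtain ⟨d, hd1, hDd⟩ := exists_one_le_forall_odd_mul (D := D)
    ⟨_, _, _, hS j₀ hj₀, hT k₀ hk₀, rfl⟩ (div_ne_zero Real.pi_ne_zero ht.ne') hDodd
    (by rintro z ⟨p, q, hp, hq, rfl⟩; exact hp.isIntegral.sub hq.isIntegral)
    (by
      rintro s z ⟨p, q, hp, hq, h⟩
      have hpK : p ∈ algebraicClosure ℚ ℂ :=
        mem_algebraicClosure_iff.2 (hp.isIntegral.tower_top.isAlgebraic)
      have hqK : q ∈ algebraicClosure ℚ ℂ :=
        mem_algebraicClosure_iff.2 (hq.isIntegral.tower_top.isAlgebraic)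
      have hz : z = ⟨p, hpK⟩ - ⟨q, hqK⟩ := Subtype.ext h
      exact ⟨_, _, HasUnitEigenvector.galois s (z := ⟨p, hpK⟩) hp,
        HasUnitEigenvector.galois s (z := ⟨q, hqK⟩) hq, by rw [hz, map_sub]; rfl⟩)
  have hdiff : ∀ j k, v j ≠ 0 → u k a ≠ 0 → ∃ n : ℤ, Odd n ∧ mu j - lam k = n * d := by
    intro j k hj hk
    obtain ⟨n, hn, h⟩ := hDd _ ⟨_, _, hS j hj, hT k hk, rfl⟩
    exact ⟨n, hn, by exact_mod_cast h⟩
  have hd0 : 0 < d := by linarith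
  have hgap : ∀ j k, v j ≠ 0 → u k a ≠ 0 → d ≤ |mu j - lam k| := by
    intro j k hj hk
    obtain ⟨n, hn, h⟩ := hdiff j k hj hk
    have hn0 : n ≠ 0 := by rintro rfl; simp at hn
    have : (1 : ℝ) ≤ |(n : ℝ)| := by exact_mod_cast Int.one_le_abs hn0
    rw [h, abs_mul, abs_of_pos hd0]
    nlinarith
  have hlt : ∀ j, v j ≠ 0 → |mu j| < 2 / d := by
    intro j hj
    refine abs_lt_two_div_of_eq_two_mul_sum (w := fun k => u k a * u k a) (lam := lam)
      (fun k => mul_self_nonneg _) hw1 hwmean (by rw [hwvar]; linarith) hd0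
      (fun k hk => hgap j k hj (left_ne_zero_of_mul hk)) ?_
    refine eq_two_mul_sum_div_of_twoBridgeGraph (hx j) (hcases j hj).2 (hcases j hj).1 hu huc ?_
    intro k hk h
    have := hgap j k hj hk
    rw [h, sub_self, abs_zero] at this
    linarith
  have hfinal := variance_lt_three_of_progression hv0 hv1 hvmean hd1 hlt (by
    intro i j hi hj
    obtain ⟨m, hm, hm'⟩ := hdiff i k₀ hi hk₀
    obtain ⟨n, hn, hn'⟩ := hdiff j k₀ hj hk₀
    -- Comparison with one common λ makes the differences of the μ even multiples of d.
    obtain ⟨l, hl⟩ := (hm.sub_odd hn).two_dvd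
    refine ⟨l, ?_⟩
    have hl' : (m : ℝ) - n = 2 * l := by exact_mod_cast hl
    linear_combination hm' - hn' + d * hl')
  rw [hvvar] at hfinal
  linarith

end TwoBridge

/-! ### Identification with the path -/

/-- If both branches are single vertices, then the graph is the path on three vertices. -/
def twoBridgeGraphIsoPathGraph {V₁ V₂ : Type*} [Subsingleton V₁] [Subsingleton V₂]
    (Y₁ : SimpleGraph V₁) (a : V₁) (Y₂ : SimpleGraph V₂) (b : V₂) :
    twoBridgeGraph Y₁ a Y₂ b ≃g SimpleGraph.pathGraph 3 where
  toFun := Sum.elim (fun _ => 0) (Sum.elim (fun _ => 1) fun _ => 2)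
  invFun := ![Sum.inl a, Sum.inr (Sum.inl ()), Sum.inr (Sum.inr b)]
  left_inv := by
    rintro (u | u | u)
    · simp [Subsingleton.elim u a]
    · rfl
    · simp [Subsingleton.elim u b]
  right_inv := by
    intro i
    fin_cases i <;> rfl
  map_rel_iff' := by
    rintro (u | u | u) (v | v | v) <;>
      simp [SimpleGraph.pathGraph_adj, twoBridgeGraph_adj, twoBridgeAdj,
        eq_iff_true_of_subsingleton]
    · exact fun h => h.ne (Subsingleton.elim _ _)
    · exact fun h => h.ne (Subsingleton.elim _ _)

theorem SimpleGraph.Connected.subsingleton_of_degree_eq_zero {V : Type*} [Fintype V]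
    {G : SimpleGraph V} [DecidableRel G.Adj] (hG : G.Connected) {a : V} (ha : G.degree a = 0) :
    Subsingleton V := by
  by_contra h
  rw [not_subsingleton_iff_nontrivial] at h
  exact (hG.preconnected.degree_pos_of_nontrivial a).ne' ha

theorem mainTheorem2 {V₁ V₂ : Type*} [Fintype V₁] [Fintype V₂]
    (Y₁ : SimpleGraph V₁) (Y₂ : SimpleGraph V₂)
    (hY₁ : Y₁.Connected) (hY₂ : Y₂.Connected) (a : V₁) (b : V₂)
    (hpst : HasPerfectStateTransfer (twoBridgeGraph Y₁ a Y₂ b)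
      (Sum.inl a) (Sum.inr (Sum.inr b))) :
    Fintype.card V₁ = 1 ∧ Fintype.card V₂ = 1 ∧
      Nonempty (twoBridgeGraph Y₁ a Y₂ b ≃g SimpleGraph.pathGraph 3) := by
  classical
  obtain ⟨t, γ, ht, hγ, ha, hb⟩ := hpst.exists_mulVec_single (by simp)
  have h₁ : Y₁.degree a = 0 := degree_eq_zero_of_exp_twoBridgeGraph ht hγ ha hb
  have h₂ : Y₂.degree b = 0 := by
    -- Closed walks of length 2 count the degree, so the second branch needs no separate spectral
    -- argument.
    have h := adjMatrix_pow_apply_eq_of_twoBridgeGraph (Y₁ := Y₁) (Y₂ := Y₂) (a := a) (b := b)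
      (pow_apply_eq_of_exp_mulVec_single hγ (SimpleGraph.isSymm_adjMatrix _) ha hb) 2
    rw [sq, sq, SimpleGraph.adjMatrix_mul_self_apply_self,
      SimpleGraph.adjMatrix_mul_self_apply_self, h₁] at h
    exact_mod_cast h.symm
  have := hY₁.subsingleton_of_degree_eq_zero h₁
  have := hY₂.subsingleton_of_degree_eq_zero h₂
  exact ⟨Fintype.card_eq_one_iff.2 ⟨a, fun _ => Subsingleton.elim _ _⟩,
    Fintype.card_eq_one_iff.2 ⟨b, fun _ => Subsingleton.elim _ _⟩,
    ⟨twoBridgeGraphIsoPathGraph Y₁ a Y₂ b⟩⟩
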